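/- Let $\{c_n\}_{n\ge1}$ be a real sequence and let $\{d_n\}_{n\ge1}$ be a positive chain sequence, i.e. $d_n=(1-g_{n-1})g_n$ for all $n\ge1$ for some real sequence $\{g_n\}_{n\ge0}$ (a parameter sequence of $\{d_n\}$) with $0\le g_0<1$ and $0<g_n<1$ for $n\ge1$. Let $\{m_n\}_{n\ge0}$ be its minimal (termwise least) parameter sequence. Let the polynomials $R_n$, $Q_n$ be given by $R_0=1$, $R_1(z)=(1+ic_1)z+(1-ic_1)$, $Q_0=0$, $Q_1=2d_1$, where both $Y_n=R_n$ and $Y_n=Q_n$ satisfy $$Y_{n+1}(z)=\big[(1+ic_{n+1})z+(1-ic_{n+1})\big]Y_n(z)-4d_{n+1}z\,Y_{n-1}(z),\qquad n\ge1 .$$ Let $\nu_j$, $j\in\mathbb Z$, be the numbers determined by the correspondence properties $$-\sum_{k\ge0}\nu_{k+1}z^k-\frac{Q_n(z)}{R_n(z)}=O(z^n)\ \ (z\to0),\qquad \sum_{k\ge0}\frac{\nu_{-k}}{z^{k+1}}-\frac{Q_n(z)}{R_n(z)}=O(z^{-n-1})\ \ (z\to\infty),\qquad n\ge0,$$ understood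 as identities of formal power series in $z$ and in $1/z$. Then there is exactly one probability measure $\mu$ on the unit circle $\mathcal C$ with $\int_{\mathcal C}\zeta^{-j}(1-\zeta)\,d\mu(\zeta)=\nu_j$ for all $j\in\mathbb Z$, and $\mu$ is nontrivial (its support is infinite). If the polynomials $S_n$ are given by $S_0=1$ and $$S_n(z)\prod_{k=1}^n(1+ic_k)=R_n(z)-2(1-m_n)R_{n-1}(z),\qquad n\ge1,$$ then $\{S_n\}$ is the sequence of monic orthogonal polynomials on the unit circle for $\mu$: $S_n$ is monic of degree $n$ and $\int_{\mathcal C}\overline{S_m(\zeta)}S_n(\zeta)\,d\mu(\zeta)=\delta_{mn}\kappa_n^{-2}$ with $\kappa_n>0$. Consequently the Verblunsky coefficients $\alpha_{n-1}=-\overline{S_n(0)}$ are $$\alpha_{n-1}=\frac{1-2m_n-ic_n}{1+ic_n}\prod_{k=1}^n\frac{1+ic_k}{1-ic_k},\qquad n\ge1 .$$ -/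

import Mathlib

open Polynomial MeasureTheory
open scoped ComplexConjugate

namespace ChainOPUC

/-- `g = (g₀, g₁, …)` is a parameter sequence of the sequence `d = (d₁, d₂, …)`:
`0 ≤ g₀ < 1`, `0 < gₙ < 1` and `dₙ = (1 - gₙ₋₁) gₙ` for `n ≥ 1`. The value `d 0` plays no role. -/
structure IsParameterSequence (d g : ℕ → ℝ) : Prop where
  zero_nonneg : 0 ≤ g 0
  zero_lt_one : g 0 < 1
  pos : ∀ n, 1 ≤ n → 0 < g n
  lt_one : ∀ n, 1 ≤ n → g n < 1
  eq : ∀ n, 1 ≤ n → d n = (1 - g (n - 1)) * g n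

/-- `(d₁, d₂, …)` is a positive chain sequence if it has a parameter sequence. -/
def IsPositiveChainSequence (d : ℕ → ℝ) : Prop :=
  ∃ g, IsParameterSequence d g

/-- The minimal parameter sequence: the (termwise) least parameter sequence. -/
def IsMinimalParameterSequence (d m : ℕ → ℝ) : Prop :=
  IsLeast {g : ℕ → ℝ | IsParameterSequence d g} m

/-- The factor `(1 + i cₙ) z + (1 - i cₙ)`. -/
noncomputable def linFactor (c : ℕ → ℝ) (n : ℕ) : ℂ[X] :=
  C (1 + Complex.I * (c n : ℂ)) * X + C (1 - Complex.I * (c n : ℂ))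

/-- `R₀ = 1`, `R₁ = (1 + i c₁) z + (1 - i c₁)`,
`Rₙ₊₁ = [(1 + i cₙ₊₁) z + (1 - i cₙ₊₁)] Rₙ - 4 dₙ₊₁ z Rₙ₋₁` for `n ≥ 1`. -/
noncomputable def R (c d : ℕ → ℝ) : ℕ → ℂ[X]
  | 0 => 1
  | 1 => linFactor c 1
  | n + 2 => linFactor c (n + 2) * R c d (n + 1) - C (4 * (d (n + 2) : ℂ)) * X * R c d n

/-- `Q₀ = 0`, `Q₁ = 2 d₁`, and the same three term recurrence as for `R`. -/
noncomputable def Q (c d : ℕ → ℝ) : ℕ → ℂ[X]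
  | 0 => 0
  | 1 => C (2 * (d 1 : ℂ))
  | n + 2 => linFactor c (n + 2) * Q c d (n + 1) - C (4 * (d (n + 2) : ℂ)) * X * Q c d n

/-- The power series expansion of `Qₙ / Rₙ` about the origin (note `Rₙ(0) ≠ 0`). -/
noncomputable def expansionZero (c d : ℕ → ℝ) (n : ℕ) : PowerSeries ℂ :=
  (Q c d n : PowerSeries ℂ) * (R c d n : PowerSeries ℂ)⁻¹

/-- For `n ≥ 1`, the expansion of `z Qₙ(z) / Rₙ(z)` about infinity, as a power series in `1 / z`:
here `z⁻ⁿ Rₙ(z)` and `z⁻⁽ⁿ⁻¹⁾ Qₙ(z)` are the polynomials in `1 / z` with reversed coefficients. -/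
noncomputable def expansionInfty (c d : ℕ → ℝ) (n : ℕ) : PowerSeries ℂ :=
  (reflect (n - 1) (Q c d n) : PowerSeries ℂ) * (reflect n (R c d n) : PowerSeries ℂ)⁻¹

/-- The numbers `νⱼ = 𝓝[ζ⁻ʲ]`, `j ∈ ℤ`, i.e. the coefficients of the formal series
`E₀(z) = - ν₁ - ν₂ z - ν₃ z² - …` and `E_∞(z) = ν₀ / z + ν₋₁ / z² + ν₋₂ / z³ + …` to which the
expansions of `Qₙ / Rₙ` about `0` and `∞` converge coefficientwise. The coefficient of `zᵏ` (resp.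
of `z⁻⁽ᵏ⁺¹⁾`) is the same for all `n ≥ k + 1` (see `coeff_expansionZero`, `coeff_expansionInfty`),
and it is read off at `n = k + 1`. -/
noncomputable def nu (c d : ℕ → ℝ) : ℤ → ℂ
  | Int.ofNat 0 => PowerSeries.coeff 0 (expansionInfty c d 1)
  | Int.ofNat (k + 1) => -PowerSeries.coeff k (expansionZero c d (k + 1))
  | Int.negSucc k => PowerSeries.coeff (k + 1) (expansionInfty c d (k + 2))

lemma linFactor_coeff_zero (c : ℕ → ℝ) (n : ℕ) :
    (linFactor c n).coeff 0 = 1 - Complex.I * (c n : ℂ) := by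
  simp [linFactor]

lemma one_sub_ne (x : ℝ) : (1 - Complex.I * (x : ℂ)) ≠ 0 := by
  intro h
  have := congrArg Complex.re h
  simp at this

lemma one_add_ne (x : ℝ) : (1 + Complex.I * (x : ℂ)) ≠ 0 := by
  intro h
  have := congrArg Complex.re h
  simp at this

lemma R_coeff_zero_ne (c d : ℕ → ℝ) : ∀ n, (R c d n).coeff 0 ≠ 0
  | 0 => by simp [R]
  | 1 => by simpa [R, linFactor_coeff_zero] using one_sub_ne (c 1)
  | n + 2 => by
    have h := R_coeff_zero_ne c d (n + 1)
    have h2 := one_sub_ne (c (n + 2))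
    simpa [R, mul_coeff_zero, linFactor_coeff_zero] using ⟨h2, h⟩

/-- The determinant formula, without the value of the constant. -/
lemma det_formula (c d : ℕ → ℝ) (n : ℕ) :
    ∃ a : ℂ, Q c d (n + 1) * R c d n - Q c d n * R c d (n + 1) = C a * X ^ n := by
  induction n with
  | zero => exact ⟨2 * (d 1 : ℂ), by simp [Q, R]⟩
  | succ n ih =>
    obtain ⟨a, ha⟩ := ih
    refine ⟨4 * (d (n + 2) : ℂ) * a, ?_⟩
    rw [C_mul, pow_succ]
    linear_combination (norm := (simp only [Q, R]; ring)) C (4 * (d (n + 2) : ℂ)) * X * ha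

lemma R_natDegree_le (c d : ℕ → ℝ) : ∀ n, (R c d n).natDegree ≤ n
  | 0 => by simp [R]
  | 1 => by simp only [R, linFactor]; compute_degree
  | n + 2 => by
    have h1 := R_natDegree_le c d (n + 1)
    have h2 := R_natDegree_le c d n
    have hl : (linFactor c (n + 2)).natDegree ≤ 1 := by
      simp only [linFactor]; compute_degree
    have hx : (C (4 * (d (n + 2) : ℂ)) * X).natDegree ≤ 1 := by compute_degree
    simp only [R]
    refine (natDegree_sub_le _ _).trans (max_le ?_ ?_)
    · exact natDegree_mul_le.trans (by omega)
    · exact natDegree_mul_le.trans (by omega)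

lemma Q_natDegree_le (c d : ℕ → ℝ) : ∀ n, (Q c d n).natDegree ≤ n - 1
  | 0 => by simp [Q]
  | 1 => (natDegree_C _).le
  | 2 => by
    have hl : (linFactor c 2).natDegree ≤ 1 := by
      simp only [linFactor]; compute_degree
    have h : Q c d 2 = linFactor c 2 * C (2 * (d 1 : ℂ)) := by simp only [Q, mul_zero, sub_zero]
    rw [h]
    exact natDegree_mul_le.trans (by rw [natDegree_C]; exact hl)
  | n + 3 => by
    have h1 := Q_natDegree_le c d (n + 2)
    have h2 := Q_natDegree_le c d (n + 1)
    have hl : (linFactor c (n + 3)).natDegree ≤ 1 := by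
      simp only [linFactor]; compute_degree
    have hx : (C (4 * (d (n + 3) : ℂ)) * X).natDegree ≤ 1 := by compute_degree
    have h : Q c d (n + 3) = linFactor c (n + 3) * Q c d (n + 2)
        - C (4 * (d (n + 3) : ℂ)) * X * Q c d (n + 1) := by rw [Q]
    rw [h]
    refine (natDegree_sub_le _ _).trans (max_le ?_ ?_)
    · exact natDegree_mul_le.trans (by omega)
    · exact natDegree_mul_le.trans (by omega)

lemma R_coeff_self_ne (c d : ℕ → ℝ) : ∀ n, (R c d n).coeff n ≠ 0
  | 0 => by simp [R]
  | 1 => by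
    have h : (R c d 1).coeff 1 = 1 + Complex.I * (c 1 : ℂ) := by
      simp only [R, linFactor, coeff_add, coeff_C_mul, coeff_X_one, coeff_C_succ, mul_one, add_zero]
    rw [h]
    exact one_add_ne (c 1)
  | n + 2 => by
    have h := R_coeff_self_ne c d (n + 1)
    have h2 := one_add_ne (c (n + 2))
    have h3 : (R c d (n + 1)).coeff (n + 2) = 0 :=
      coeff_eq_zero_of_natDegree_lt ((R_natDegree_le c d (n + 1)).trans_lt (by omega))
    have h4 : (R c d n).coeff (n + 1) = 0 :=
      coeff_eq_zero_of_natDegree_lt ((R_natDegree_le c d n).trans_lt (by omega))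
    have : (R c d (n + 2)).coeff (n + 2)
        = (1 + Complex.I * (c (n + 2) : ℂ)) * (R c d (n + 1)).coeff (n + 1) := by
      simp only [R, linFactor, add_mul, mul_assoc, coeff_sub, coeff_add, coeff_C_mul, coeff_X_mul,
        h3, h4]
      ring
    rw [this]
    exact mul_ne_zero h2 h

/-- The difference of two quotients of power series whose cross difference is a multiple of `Xⁿ`
has vanishing coefficients below `n`. -/
lemma coeff_quot_eq {p q p' q' : PowerSeries ℂ} (hq : PowerSeries.constantCoeff q ≠ 0)
    (hq' : PowerSeries.constantCoeff q' ≠ 0) {n k : ℕ} {u : PowerSeries ℂ}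
    (h : p' * q - p * q' = u * PowerSeries.X ^ n) (hk : k < n) :
    PowerSeries.coeff k (p' * q'⁻¹) = PowerSeries.coeff k (p * q⁻¹) := by
  have e1 := PowerSeries.mul_inv_cancel q hq
  have e2 := PowerSeries.mul_inv_cancel q' hq'
  have : p' * q'⁻¹ - p * q⁻¹ = PowerSeries.X ^ n * (u * q⁻¹ * q'⁻¹) := by
    linear_combination (q⁻¹ * q'⁻¹) * h + (-p' * q'⁻¹) * e1 + (p * q⁻¹) * e2
  rw [← sub_eq_zero, ← map_sub, this, PowerSeries.coeff_X_pow_mul', if_neg (by omega)]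

lemma coeff_expansionZero_succ (c d : ℕ → ℝ) {n k : ℕ} (hk : k < n) :
    PowerSeries.coeff k (expansionZero c d (n + 1)) =
      PowerSeries.coeff k (expansionZero c d n) := by
  obtain ⟨a, ha⟩ := det_formula c d n
  refine coeff_quot_eq (u := PowerSeries.C a) ?_ ?_ ?_ hk
  · simpa using R_coeff_zero_ne c d n
  · simpa using R_coeff_zero_ne c d (n + 1)
  · simpa using congrArg (fun p : ℂ[X] => (p : PowerSeries ℂ)) ha

lemma coeff_expansionInfty_succ (c d : ℕ → ℝ) {n k : ℕ} (hk : k < n) :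
    PowerSeries.coeff k (expansionInfty c d (n + 1)) =
      PowerSeries.coeff k (expansionInfty c d n) := by
  obtain ⟨a, ha⟩ := det_formula c d n
  have hr := congrArg (reflect (2 * n)) ha
  have e1 : reflect (2 * n) (Q c d (n + 1) * R c d n)
      = reflect n (Q c d (n + 1)) * reflect n (R c d n) := by
    rw [two_mul]
    exact reflect_mul _ _ (by simpa using Q_natDegree_le c d (n + 1)) (R_natDegree_le c d n)
  have e2 : reflect (2 * n) (Q c d n * R c d (n + 1))
      = reflect (n - 1) (Q c d n) * reflect (n + 1) (R c d (n + 1)) := by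
    rw [show 2 * n = (n - 1) + (n + 1) by omega]
    exact reflect_mul _ _ (Q_natDegree_le c d n) (R_natDegree_le c d (n + 1))
  have e3 : reflect (2 * n) (C a * X ^ n) = C a * X ^ n := by
    rw [reflect_C_mul_X_pow, revAt_le (by omega), show 2 * n - n = n by omega]
  rw [reflect_sub, e1, e2, e3] at hr
  refine coeff_quot_eq (u := PowerSeries.C a) ?_ ?_ ?_ hk
  · simpa [coeff_reflect, revAt_le] using R_coeff_self_ne c d n
  · simpa [coeff_reflect, revAt_le] using R_coeff_self_ne c d (n + 1)
  · simpa using congrArg (fun p : ℂ[X] => (p : PowerSeries ℂ)) hr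

/-- Correspondence at the origin: `E₀(z) - Qₙ(z) / Rₙ(z) = O(zⁿ)`. -/
theorem coeff_expansionZero (c d : ℕ → ℝ) {n k : ℕ} (hk : k < n) :
    PowerSeries.coeff k (expansionZero c d n) = -nu c d (k + 1) := by
  obtain ⟨j, rfl⟩ := Nat.exists_eq_add_of_lt hk
  have h0 : nu c d (k + 1) = -PowerSeries.coeff k (expansionZero c d (k + 1)) := rfl
  rw [h0, neg_neg]
  induction j with
  | zero => rfl
  | succ j ih =>
    exact (coeff_expansionZero_succ c d (n := k + j + 1) (by omega)).trans (ih (by omega))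

/-- Correspondence at infinity: `E_∞(z) - Qₙ(z) / Rₙ(z) = O((1 / z)ⁿ⁺¹)`. -/
theorem coeff_expansionInfty (c d : ℕ → ℝ) {n k : ℕ} (hk : k < n) :
    PowerSeries.coeff k (expansionInfty c d n) = nu c d (-k) := by
  obtain ⟨j, rfl⟩ := Nat.exists_eq_add_of_lt hk
  have h0 : nu c d (-k) = PowerSeries.coeff k (expansionInfty c d (k + 1)) := by
    cases k with
    | zero => rfl
    | succ k => rfl
  rw [h0]
  induction j with
  | zero => rfl
  | succ j ih =>
    exact (coeff_expansionInfty_succ c d (n := k + j + 1) (by omega)).trans (ih (by omega))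

/-- The unit circle carries its Borel σ-algebra. -/
noncomputable instance circleMeasurableSpace : MeasurableSpace Circle := borel Circle

instance circleBorelSpace : BorelSpace Circle := ⟨rfl⟩

/-- `μ` is a probability measure on the unit circle with
`∫ ζ⁻ʲ (1 - ζ) dμ(ζ) = νⱼ = 𝓝[ζ⁻ʲ]` for all integers `j`. -/
structure IsAssociatedMeasure (c d : ℕ → ℝ) (μ : Measure Circle) : Prop where
  isProbabilityMeasure : IsProbabilityMeasure μ
  moment : ∀ j : ℤ, ∫ ζ : Circle, (ζ : ℂ) ^ (-j) * (1 - (ζ : ℂ)) ∂μ = nu c d j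

/-- A measure on the unit circle is nontrivial if its support is infinite. -/
def IsNontrivial (μ : Measure Circle) : Prop :=
  μ.support.Infinite

/-- `S` is the sequence of monic orthogonal polynomials on the unit circle for `μ`:
`Sₙ` is monic of degree `n` and `∫ conj(Sₘ) Sₙ dμ = δₘₙ κₙ⁻²` with `κₙ > 0`. -/
structure IsMonicOPUC (μ : Measure Circle) (S : ℕ → ℂ[X]) : Prop where
  monic : ∀ n, (S n).Monic
  natDegree : ∀ n, (S n).natDegree = n
  orthogonal : ∃ κ : ℕ → ℝ, (∀ n, 0 < κ n) ∧ ∀ m n,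
    ∫ ζ : Circle, conj ((S m).eval (ζ : ℂ)) * (S n).eval (ζ : ℂ) ∂μ =
      if m = n then (((κ n) ^ 2)⁻¹ : ℂ) else 0

/-- The Verblunsky coefficients `αₙ = - conj(Sₙ₊₁(0))`, `n ≥ 0`, belonging to the monic orthogonal
polynomials `S`. -/
noncomputable def verblunsky (S : ℕ → ℂ[X]) (n : ℕ) : ℂ :=
  -conj ((S (n + 1)).eval 0)

end ChainOPUC

/-! Let N be the functional on Laurent polynomials with N[ζ⁻ʲ] = νⱼ, and L the one with L[ζ⁻ʲ] = μⱼ,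
where μ₀ = 1 and μⱼ - μⱼ₋₁ = νⱼ; then L[(1 - ζ)f] = N[f]. The two correspondence properties together
give N[ζ⁻ᵏRₙ] = 0 for 1 ≤ k ≤ n (`functional_nu_R`). Since Rₙ and Qₙ are self-inversive, the μⱼ are
Hermitian (`nu_neg`, `moment_neg`).

The three-term recurrence gives L[Rₙ] = 2(1 - mₙ)L[Rₙ₋₁] (`functional_moment_R_succ`), so the
combination defining Sₙ is the one annihilated by L. Passing from ζ⁻ᵏ to ζ⁻ᵏ⁻¹ changes L by a value
of N that vanishes on both Rₙ and Rₙ₋₁, hence L[ζ⁻ᵏSₙ] = 0 for all k < n (`functional_moment_S`).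
The first nonzero value is L[ζ⁻ⁿSₙ] = (1 - mₙ) ∏ 4dₖ/(1 + cₖ²) > 0 (`functional_moment_S_self`).
Minimality is used only through m₀ = 0.

A monic orthogonal basis of positive norms makes the Hermitian form of L positive
(`form_self_nonneg`), so Herglotz' theorem supplies μ, and density of trigonometric polynomials
makes it unique (`measure_eq_of_moment_eq`). Positive norms of every degree exclude finite support,
and the Verblunsky coefficients are read off from constant terms. -/

namespace ChainOPUC

/-! ### Moment functionals and the orthogonality of Rₙ -/

/-- The value at `ζ⁻ᵏ p(ζ)` of the linear functional on Laurent polynomials with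
`ζ⁻ʲ ↦ u j`. -/
noncomputable def functional (u : ℤ → ℂ) (k : ℤ) : ℂ[X] →ₗ[ℂ] ℂ :=
  lsum fun j => u (k - j) • LinearMap.id

lemma functional_apply (u : ℤ → ℂ) (k : ℤ) (p : ℂ[X]) :
    functional u k p = p.sum fun j a => u (k - j) * a := rfl

lemma functional_eq_sum (u : ℤ → ℂ) (k : ℤ) {p : ℂ[X]} {n : ℕ} (h : p.natDegree < n) :
    functional u k p = ∑ j ∈ Finset.range n, u (k - j) * p.coeff j := by
  rw [functional_apply, sum_over_range' _ (by simp) n h]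

lemma functional_C_mul (u : ℤ → ℂ) (k : ℤ) (a : ℂ) (p : ℂ[X]) :
    functional u k (C a * p) = a * functional u k p := by
  rw [← smul_eq_C_mul, map_smul, smul_eq_mul]

lemma functional_X_mul (u : ℤ → ℂ) (k : ℤ) (p : ℂ[X]) :
    functional u k (X * p) = functional u (k - 1) p := by
  induction p using Polynomial.induction_on' with
  | add p q hp hq => simp only [mul_add, map_add, hp, hq]
  | monomial n a =>
    rw [X_mul_monomial, functional_apply, functional_apply, sum_monomial_index _ _ (by simp),
      sum_monomial_index _ _ (by simp)]
    push_cast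
    ring_nf

lemma functional_linFactor_mul (u : ℤ → ℂ) (k : ℤ) (c : ℕ → ℝ) (n : ℕ) (p : ℂ[X]) :
    functional u k (linFactor c n * p) =
      (1 + Complex.I * c n) * functional u (k - 1) p
        + (1 - Complex.I * c n) * functional u k p := by
  rw [linFactor, add_mul, mul_assoc, map_add, functional_C_mul, functional_X_mul, functional_C_mul]

lemma functional_R_succ_succ (u : ℤ → ℂ) (k : ℤ) (c d : ℕ → ℝ) (n : ℕ) :
    functional u k (R c d (n + 2)) =
      (1 + Complex.I * c (n + 2)) * functional u (k - 1) (R c d (n + 1))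
        + (1 - Complex.I * c (n + 2)) * functional u k (R c d (n + 1))
        - 4 * d (n + 2) * functional u (k - 1) (R c d n) := by
  rw [R, map_sub, functional_linFactor_mul, mul_assoc, functional_C_mul, functional_X_mul]

lemma functional_R_one (u : ℤ → ℂ) (k : ℤ) (c d : ℕ → ℝ) :
    functional u k (R c d 1) =
      (1 + Complex.I * c 1) * functional u (k - 1) 1
        + (1 - Complex.I * c 1) * functional u k 1 := by
  rw [R, ← functional_linFactor_mul, mul_one]

lemma functional_one (u : ℤ → ℂ) (k : ℤ) : functional u k 1 = u k := by
  rw [functional_eq_sum u k (n := 1) (by simp)]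
  simp

/-- The left side is the `u`-functional at ζ⁻ᵏ(1 - ζ)p. This is the bridge between the moments of μ
and the numbers ν. -/
lemma functional_sub_functional {u v : ℤ → ℂ} (h : ∀ j, u j - u (j - 1) = v j) (k : ℤ)
    (p : ℂ[X]) : functional u k p - functional u (k - 1) p = functional v k p := by
  simp only [functional_eq_sum _ _ (Nat.lt_succ_self p.natDegree), ← Finset.sum_sub_distrib]
  refine Finset.sum_congr rfl fun j _ => ?_
  rw [← h (k - j), sub_right_comm]
  ring

lemma expansionZero_mul (c d : ℕ → ℝ) (n : ℕ) :
    expansionZero c d n * (R c d n : PowerSeries ℂ) = Q c d n :=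
  (PowerSeries.eq_mul_inv_iff_mul_eq (by simpa using R_coeff_zero_ne c d n)).1 rfl

lemma expansionInfty_mul (c d : ℕ → ℝ) (n : ℕ) :
    expansionInfty c d n * (reflect n (R c d n) : PowerSeries ℂ) = reflect (n - 1) (Q c d n) :=
  (PowerSeries.eq_mul_inv_iff_mul_eq
    (by simpa [coeff_reflect, revAt_le] using R_coeff_self_ne c d n)).1 rfl

/-- Orthogonality of `Rₙ` with respect to the functional with moments `ν`. -/
lemma functional_nu_R (c d : ℕ → ℝ) {n k : ℕ} (hk : k < n) :
    functional (nu c d) (k + 1) (R c d n) = 0 := by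
  have h0 := congrArg (PowerSeries.coeff k) (expansionZero_mul c d n)
  -- Under reversal in degree n - 1, this coefficient of the expansion at infinity is the k-th
  -- coefficient of Qₙ, the same one as in `h0`.
  have h1 := congrArg (PowerSeries.coeff (n - 1 - k)) (expansionInfty_mul c d n)
  rw [PowerSeries.coeff_mul, Finset.Nat.sum_antidiagonal_eq_sum_range_succ_mk,
    ← Finset.sum_range_reflect, coeff_coe] at h0
  rw [PowerSeries.coeff_mul, Finset.Nat.sum_antidiagonal_eq_sum_range_succ_mk, coeff_coe,
    coeff_reflect, revAt_le (by omega), show n - 1 - (n - 1 - k) = k by omega] at h1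
  rw [functional_eq_sum _ _ (Nat.lt_succ_of_le (R_natDegree_le c d n)),
    -- Terms with j ≤ k involve ν of positive index (expansion at 0), the others ν of index ≤ 0
    -- (expansion at ∞). The halves are minus and plus the k-th coefficient of Qₙ.
    show n.succ = (k + 1) + (n - 1 - k).succ by omega, Finset.sum_range_add]
  have e0 : ∑ j ∈ Finset.range (k + 1), nu c d (k + 1 - j) * (R c d n).coeff j =
      -(Q c d n).coeff k := by
    rw [← h0, ← Finset.sum_neg_distrib]
    refine Finset.sum_congr rfl fun j hj => ?_
    have hj' := Finset.mem_range.1 hj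
    dsimp only
    rw [coeff_coe, coeff_expansionZero c d (by omega), neg_mul, neg_neg,
      show k - (k.succ - 1 - j) = j by omega,
      show ((k.succ - 1 - j : ℕ) : ℤ) + 1 = k + 1 - j by omega]
  have e1 : ∑ j ∈ Finset.range (n - 1 - k).succ,
      nu c d (k + 1 - (k + 1 + j : ℕ)) * (R c d n).coeff (k + 1 + j) = (Q c d n).coeff k := by
    rw [← h1]
    refine Finset.sum_congr rfl fun j hj => ?_
    have hj' := Finset.mem_range.1 hj
    dsimp only
    rw [coeff_coe, coeff_expansionInfty c d (by omega), coeff_reflect, revAt_le (by omega),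
      show n - (n - 1 - k - j) = k + 1 + j by omega,
      show (k : ℤ) + 1 - (k + 1 + j : ℕ) = -j by omega]
  rw [e0, e1, neg_add_cancel]

/-! ### Self-inversive symmetry and Hermitian moments -/

lemma natDegree_linFactor_le (c : ℕ → ℝ) (n : ℕ) : (linFactor c n).natDegree ≤ 1 := by
  simp only [linFactor]; compute_degree

lemma reflect_linFactor (c : ℕ → ℝ) (n : ℕ) :
    reflect 1 (linFactor c n) = (linFactor c n).map (starRingEnd ℂ) := by
  have h : reflect 1 (X : ℂ[X]) = 1 := by simp
  simp only [linFactor, reflect_add, reflect_C_mul, reflect_C, h, Polynomial.map_add,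
    Polynomial.map_mul, map_C, map_X]
  simp [sub_eq_add_neg, add_comm]

/-- As c and d are real, `linFactor` is self-inversive in degree 1 and 4dX in degree 2, so the
recurrence preserves self-inversiveness. It serves both R and Q. -/
lemma reflect_three_term (c : ℕ → ℝ) (d : ℝ) (N m : ℕ) {p q : ℂ[X]} (hp : p.natDegree ≤ m + 1)
    (hq : q.natDegree ≤ m) (hp' : reflect (m + 1) p = p.map (starRingEnd ℂ))
    (hq' : reflect m q = q.map (starRingEnd ℂ)) :
    reflect (m + 2) (linFactor c N * p - C (4 * (d : ℂ)) * X * q) =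
      (linFactor c N * p - C (4 * (d : ℂ)) * X * q).map (starRingEnd ℂ) := by
  have hx : reflect 2 (X : ℂ[X]) = X := by simpa using reflect_monomial 2 1 (R := ℂ)
  rw [reflect_sub, mul_assoc, reflect_C_mul, show m + 2 = 1 + (m + 1) by omega,
    reflect_mul _ _ (natDegree_linFactor_le c N) hp, show 1 + (m + 1) = 2 + m by omega,
    reflect_mul _ _ (natDegree_X_le.trans one_le_two) hq, hx, hp', hq', reflect_linFactor]
  simp [Complex.conj_ofNat, mul_assoc]

lemma reflect_R (c d : ℕ → ℝ) : ∀ n, reflect n (R c d n) = (R c d n).map (starRingEnd ℂ)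
  | 0 => by simp [R]
  | 1 => by simp only [R, reflect_linFactor]
  | n + 2 => by
    rw [R]
    exact reflect_three_term c _ _ n (R_natDegree_le c d _) (R_natDegree_le c d _)
      (reflect_R c d (n + 1)) (reflect_R c d n)

lemma reflect_Q_succ (c d : ℕ → ℝ) :
    ∀ n, reflect n (Q c d (n + 1)) = (Q c d (n + 1)).map (starRingEnd ℂ)
  | 0 => by simp [Q, reflect_C, Complex.conj_ofNat]
  | 1 => by
    have h : Q c d 2 = C (2 * (d 1 : ℂ)) * linFactor c 2 := by
      rw [Q, Q, Q]; ring
    rw [h, reflect_C_mul, reflect_linFactor]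
    simp [Complex.conj_ofNat]
  | n + 2 => by
    have h : Q c d (n + 2 + 1) = linFactor c (n + 2 + 1) * Q c d (n + 1 + 1)
        - C (4 * (d (n + 2 + 1) : ℂ)) * X * Q c d (n + 1) := by rw [Q]
    rw [h]
    exact reflect_three_term c _ _ n (Q_natDegree_le c d _) (Q_natDegree_le c d _)
      (reflect_Q_succ c d (n + 1)) (reflect_Q_succ c d n)

/-- Numerator and denominator are both self-inversive, so reversing their coefficients amounts to
conjugating them. -/
lemma expansionInfty_succ (c d : ℕ → ℝ) (n : ℕ) :
    expansionInfty c d (n + 1) =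
      PowerSeries.map (starRingEnd ℂ) (expansionZero c d (n + 1)) := by
  symm
  rw [expansionInfty, PowerSeries.eq_mul_inv_iff_mul_eq
    (by simpa [coeff_reflect, revAt_le] using R_coeff_self_ne c d (n + 1)), reflect_R,
    Nat.add_sub_cancel, reflect_Q_succ, polynomial_map_coe, polynomial_map_coe, ← map_mul,
    expansionZero_mul]

lemma nu_neg (c d : ℕ → ℝ) (k : ℕ) : nu c d (-k) = -conj (nu c d (k + 1)) := by
  rw [← coeff_expansionInfty c d (Nat.lt_succ_self k), expansionInfty_succ, PowerSeries.coeff_map,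
    coeff_expansionZero c d (Nat.lt_succ_self k), map_neg]

/-- The moments `∫ ζ⁻ʲ dμ` of the measure associated with `c` and `d`. -/
noncomputable def moment (c d : ℕ → ℝ) : ℤ → ℂ
  | Int.ofNat n => 1 + ∑ i ∈ Finset.range n, nu c d (i + 1)
  | Int.negSucc n => conj (1 + ∑ i ∈ Finset.range (n + 1), nu c d (i + 1))

lemma moment_natCast (c d : ℕ → ℝ) (n : ℕ) :
    moment c d n = 1 + ∑ i ∈ Finset.range n, nu c d (i + 1) := rfl

lemma moment_zero (c d : ℕ → ℝ) : moment c d 0 = 1 := by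
  simpa using moment_natCast c d 0

lemma moment_neg_natCast (c d : ℕ → ℝ) (n : ℕ) :
    moment c d (-n) = conj (moment c d n) := by
  cases n with
  | zero => simp [moment_zero]
  | succ n => rfl

lemma moment_neg (c d : ℕ → ℝ) (j : ℤ) : moment c d (-j) = conj (moment c d j) := by
  obtain ⟨n, rfl | rfl⟩ := j.eq_nat_or_neg
  · exact moment_neg_natCast c d n
  · rw [moment_neg_natCast, neg_neg, Complex.conj_conj]

lemma moment_sub_moment (c d : ℕ → ℝ) (j : ℤ) :
    moment c d j - moment c d (j - 1) = nu c d j := by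
  have hn (n : ℕ) : moment c d (n + 1) - moment c d n = nu c d (n + 1) := by
    have := moment_natCast c d (n + 1)
    push_cast at this
    rw [this, moment_natCast, Finset.sum_range_succ]
    ring
  -- The reflection j ↦ 1 - j of `nu_neg` exchanges these two cases.
  obtain ⟨n, rfl | rfl⟩ : ∃ n : ℕ, j = n + 1 ∨ j = -n := by
    rcases le_or_gt j 0 with h | h
    · exact ⟨j.natAbs, Or.inr (by omega)⟩
    · exact ⟨(j - 1).natAbs, Or.inl (by omega)⟩
  · simpa using hn n
  · rw [nu_neg, ← hn, ← neg_add', moment_neg, moment_neg, map_sub]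
    ring

/-! ### Minimal parameters and values of the functionals on Rₙ -/

/-- The first term of the minimal parameter sequence vanishes. -/
lemma IsMinimalParameterSequence.zero {d m : ℕ → ℝ} (hm : IsMinimalParameterSequence d m) :
    m 0 = 0 := by
  obtain ⟨hp, hl⟩ := hm
  -- The recursion forced on any parameter sequence starting at 0. It stays below `m`, hence below
  -- 1, so it is itself admissible.
  let g : ℕ → ℝ := fun n => Nat.rec 0 (fun k x => d (k + 1) / (1 - x)) n
  have hg0 : g 0 = 0 := rfl
  have hgs (n : ℕ) : g (n + 1) = d (n + 1) / (1 - g n) := rfl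
  have hm1 (n : ℕ) : m n < 1 := by
    cases n with
    | zero => exact hp.zero_lt_one
    | succ n => exact hp.lt_one _ (by omega)
  have hd (n : ℕ) : d (n + 1) = (1 - m n) * m (n + 1) := hp.eq (n + 1) (by omega)
  have hle (n : ℕ) : g n ≤ m n := by
    induction n with
    | zero => exact hp.zero_nonneg
    | succ n ih =>
      have h1 := hm1 n
      have h2 := hp.pos (n + 1) (by omega)
      rw [hgs, hd, div_le_iff₀ (by linarith)]
      nlinarith
  have hg : IsParameterSequence d g := by
    refine ⟨le_rfl, zero_lt_one, fun n hn => ?_, fun n hn => (hle n).trans_lt (hm1 n),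
      fun n hn => ?_⟩
    · obtain ⟨n, rfl⟩ := Nat.exists_eq_succ_of_ne_zero (by omega : n ≠ 0)
      have h1 := hm1 n
      have h2 := hp.pos (n + 1) (by omega)
      rw [Nat.succ_eq_add_one, hgs, hd]
      have h3 := hle n
      exact div_pos (mul_pos (by linarith) h2) (by linarith)
    · obtain ⟨n, rfl⟩ := Nat.exists_eq_succ_of_ne_zero (by omega : n ≠ 0)
      have h1 := hm1 n
      have h3 := hle n
      rw [Nat.succ_eq_add_one, Nat.add_sub_cancel, hgs, mul_div_cancel₀]
      linarith
  exact le_antisymm (hl hg 0) hp.zero_nonneg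

lemma prod_one_add_ne (c : ℕ → ℝ) (n : ℕ) :
    ∏ k ∈ Finset.Icc 1 n, (1 + Complex.I * (c k : ℂ)) ≠ 0 :=
  Finset.prod_ne_zero_iff.2 fun _ _ => one_add_ne _

lemma prod_one_sub_ne (c : ℕ → ℝ) (n : ℕ) :
    ∏ k ∈ Finset.Icc 1 n, (1 - Complex.I * (c k : ℂ)) ≠ 0 :=
  Finset.prod_ne_zero_iff.2 fun _ _ => one_sub_ne _

lemma R_coeff_zero (c d : ℕ → ℝ) :
    ∀ n, (R c d n).coeff 0 = ∏ k ∈ Finset.Icc 1 n, (1 - Complex.I * (c k : ℂ))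
  | 0 => by simp [R]
  | 1 => by simp [R, linFactor_coeff_zero]
  | n + 2 => by
    rw [Finset.prod_Icc_succ_top (by omega), ← R_coeff_zero c d (n + 1), mul_comm]
    simp [R, mul_coeff_zero, linFactor_coeff_zero]

lemma R_coeff_self (c d : ℕ → ℝ) :
    ∀ n, (R c d n).coeff n = ∏ k ∈ Finset.Icc 1 n, (1 + Complex.I * (c k : ℂ))
  | 0 => by simp [R]
  | 1 => by
    simp only [R, linFactor, coeff_add, coeff_C_mul, coeff_X_one, coeff_C_succ, mul_one, add_zero,
      Finset.Icc_self, Finset.prod_singleton]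
  | n + 2 => by
    have h3 : (R c d (n + 1)).coeff (n + 2) = 0 :=
      coeff_eq_zero_of_natDegree_lt ((R_natDegree_le c d (n + 1)).trans_lt (by omega))
    have h4 : (R c d n).coeff (n + 1) = 0 :=
      coeff_eq_zero_of_natDegree_lt ((R_natDegree_le c d n).trans_lt (by omega))
    rw [Finset.prod_Icc_succ_top (by omega), ← R_coeff_self c d (n + 1), mul_comm]
    simp only [R, linFactor, add_mul, mul_assoc, coeff_sub, coeff_add, coeff_C_mul, coeff_X_mul,
      h3, h4]
    ring

lemma nu_one (c d : ℕ → ℝ) : (1 - Complex.I * c 1) * nu c d 1 = -(2 * d 1) := by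
  have h := congrArg (PowerSeries.coeff 0) (expansionZero_mul c d 1)
  have h1 := coeff_expansionZero c d zero_lt_one
  simp only [Nat.cast_zero, zero_add] at h1
  rw [PowerSeries.coeff_mul, Finset.Nat.antidiagonal_zero, Finset.sum_singleton, h1, coeff_coe,
    coeff_coe, R_coeff_zero] at h
  simp only [Finset.Icc_self, Finset.prod_singleton, Q, coeff_C_zero] at h
  linear_combination -h

lemma nu_zero (c d : ℕ → ℝ) : (1 + Complex.I * c 1) * nu c d 0 = 2 * d 1 := by
  have h := functional_nu_R c d zero_lt_one
  rw [functional_R_one, functional_one, functional_one] at h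
  simp only [Nat.cast_zero, zero_add, sub_self] at h
  linear_combination h - nu_one c d

/-- Write xₙ = L[Rₙ]. Eliminating L[ζ·] through N[ζ⁻¹Rₙ₊₂] = 0 turns the recurrence into xₙ₊₂ =
2xₙ₊₁ - 4dₙ₊₂xₙ, and dₙ₊₂ = (1 - mₙ₊₁)mₙ₊₂ with the induction hypothesis reduces the last term to
2mₙ₊₂xₙ₊₁. The base case needs d₁ = m₁, that is m₀ = 0. -/
lemma functional_moment_R_succ {c d m : ℕ → ℝ} (hp : IsParameterSequence d m) (h0 : m 0 = 0) :
    ∀ n, functional (moment c d) 0 (R c d (n + 1)) =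
      2 * (1 - m (n + 1)) * functional (moment c d) 0 (R c d n)
  | 0 => by
    have hd : (d 1 : ℂ) = m 1 := by
      have := hp.eq 1 le_rfl
      simp only [Nat.sub_self, h0] at this
      rw [this]
      simp
    have h1 := moment_sub_moment c d 0
    have h2 := nu_zero c d
    rw [R, zero_add, functional_R_one, functional_one, functional_one]
    rw [moment_zero] at *
    rw [← hd]
    linear_combination (-(1 + Complex.I * c 1)) * h1 - h2
  | n + 1 => by
    have hd : (d (n + 2) : ℂ) = (1 - m (n + 1)) * m (n + 2) := by
      exact_mod_cast hp.eq (n + 2) (by omega)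
    have ih := functional_moment_R_succ (c := c) hp h0 n
    have h1 := functional_nu_R c d (n := n + 2) (k := 0) (by omega)
    have h2 := functional_nu_R c d (n := n + 1) (k := 0) (by omega)
    have h3 := functional_sub_functional (moment_sub_moment c d) 0 (R c d (n + 1))
    have h4 := functional_sub_functional (moment_sub_moment c d) 0 (R c d n)
    rw [functional_R_succ_succ, h2] at h1
    simp only [Nat.cast_zero, zero_add, sub_self] at h1
    rw [functional_R_succ_succ]
    linear_combination (2 * m (n + 2)) * ih - h1
      - (1 + Complex.I * c (n + 2)) * h3 + 4 * d (n + 2) * h4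
      - 4 * functional (moment c d) 0 (R c d n) * hd

/-- The first power beyond the range of orthogonality. Applying N[ζ⁻ⁿ⁻²·] to the recurrence for
Rₙ₊₂, orthogonality leaves only a relation between consecutive values. -/
lemma functional_nu_R_last (c d : ℕ → ℝ) (n : ℕ) :
    functional (nu c d) (n + 1) (R c d n) * ∏ k ∈ Finset.Icc 1 (n + 1), (1 - Complex.I * c k) =
      -(1 / 2) * ∏ k ∈ Finset.Icc 1 (n + 1), (4 * (d k : ℂ)) := by
  induction n with
  | zero =>
    have := nu_one c d
    simp only [R, Nat.cast_zero, zero_add, functional_one, Finset.Icc_self,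
      Finset.prod_singleton]
    linear_combination this
  | succ n ih =>
    have h1 := functional_nu_R c d (n := n + 2) (k := n + 1) (by omega)
    have h2 := functional_nu_R c d (n := n + 1) (k := n) (by omega)
    rw [functional_R_succ_succ, add_sub_cancel_right] at h1
    push_cast at h1 ⊢
    rw [h2] at h1
    rw [Finset.prod_Icc_succ_top (by omega) (fun k => 1 - Complex.I * (c k : ℂ)),
      Finset.prod_Icc_succ_top (by omega) (fun k => 4 * (d k : ℂ))]
    linear_combination (∏ k ∈ Finset.Icc 1 (n + 1), (1 - Complex.I * (c k : ℂ))) * h1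
      + 4 * (d (n + 2) : ℂ) * ih

/-! ### Orthogonality, norms and constant terms of Sₙ -/

section Szego

variable {c d m : ℕ → ℝ} {S : ℕ → ℂ[X]}

lemma functional_moment_S (hp : IsParameterSequence d m) (h0 : m 0 = 0)
    (hS : ∀ n : ℕ, 1 ≤ n → S n * C (∏ k ∈ Finset.Icc 1 n, (1 + Complex.I * (c k : ℂ))) =
      R c d n - C (2 * (1 - (m n : ℂ))) * R c d (n - 1)) {n k : ℕ} (hk : k < n) :
    functional (moment c d) k (S n) = 0 := by
  have h := congrArg (functional (moment c d) k) (hS n (by omega))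
  rw [mul_comm, functional_C_mul] at h
  refine (mul_eq_zero.1 (h.trans ?_)).resolve_left (prod_one_add_ne c n)
  clear h
  obtain ⟨n, rfl⟩ := Nat.exists_eq_succ_of_ne_zero (by omega : n ≠ 0)
  rw [Nat.succ_eq_add_one, Nat.add_sub_cancel, map_sub, functional_C_mul]
  induction k with
  | zero =>
    rw [Nat.cast_zero, functional_moment_R_succ hp h0, sub_self]
  | succ k ih =>
    have h1 := functional_sub_functional (moment_sub_moment c d) (k + 1) (R c d (n + 1))
    have h2 := functional_sub_functional (moment_sub_moment c d) (k + 1) (R c d n)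
    rw [functional_nu_R c d (by omega), add_sub_cancel_right] at h1 h2
    push_cast
    linear_combination h1 - 2 * (1 - (m (n + 1) : ℂ)) * h2 + ih (by omega)

/-- The squared norm `κₙ⁻²` of the `n`-th monic orthogonal polynomial. -/
noncomputable def normSqS (c d m : ℕ → ℝ) (n : ℕ) : ℝ :=
  (1 - m n) * ∏ k ∈ Finset.Icc 1 n, 4 * d k / (1 + c k ^ 2)

lemma normSqS_pos (hp : IsParameterSequence d m) (n : ℕ) : 0 < normSqS c d m n := by
  have hm (n : ℕ) : m n < 1 := by
    cases n with
    | zero => exact hp.zero_lt_one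
    | succ n => exact hp.lt_one _ (by omega)
  refine mul_pos (by linarith [hm n]) (Finset.prod_pos fun k hk => ?_)
  have hk1 := (Finset.mem_Icc.1 hk).1
  have h1 := hp.pos k hk1
  have h2 := hm (k - 1)
  rw [hp.eq k hk1]
  have : 0 < (1 - m (k - 1)) * m k := mul_pos (by linarith) h1
  positivity

lemma functional_moment_S_self (hp : IsParameterSequence d m) (h0 : m 0 = 0) (hS0 : S 0 = 1)
    (hS : ∀ n : ℕ, 1 ≤ n → S n * C (∏ k ∈ Finset.Icc 1 n, (1 + Complex.I * (c k : ℂ))) =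
      R c d n - C (2 * (1 - (m n : ℂ))) * R c d (n - 1)) (n : ℕ) :
    functional (moment c d) n (S n) = normSqS c d m n := by
  cases n with
  | zero => simp [hS0, functional_one, moment_zero, normSqS, h0]
  | succ n =>
    -- L at the previous power vanishes on Sₙ₊₁, so L may be replaced by N; N in turn kills Rₙ₊₁ and
    -- leaves only the Rₙ term.
    have h := functional_sub_functional (moment_sub_moment c d) (n + 1 : ℕ) (S (n + 1))
    have h1 := congrArg (functional (nu c d) (n + 1 : ℕ)) (hS (n + 1) (by omega))
    have h2 := functional_nu_R_last c d n
    push_cast at h h1 ⊢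
    rw [add_sub_cancel_right, functional_moment_S hp h0 hS (Nat.lt_succ_self n), sub_zero] at h
    rw [mul_comm, functional_C_mul, map_sub, functional_C_mul, functional_nu_R c d (by omega),
      ← h] at h1
    have h3 := prod_one_add_ne c (n + 1)
    have h4 := prod_one_sub_ne c (n + 1)
    have h5 : ((normSqS c d m (n + 1) : ℝ) : ℂ) = (1 - m (n + 1)) *
        ((∏ k ∈ Finset.Icc 1 (n + 1), (4 * (d k : ℂ))) /
        ((∏ k ∈ Finset.Icc 1 (n + 1), (1 + Complex.I * (c k : ℂ))) *
          ∏ k ∈ Finset.Icc 1 (n + 1), (1 - Complex.I * (c k : ℂ)))) := by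
      rw [normSqS, ← Finset.prod_mul_distrib, ← Finset.prod_div_distrib]
      push_cast
      congr 1
      refine Finset.prod_congr rfl fun k _ => ?_
      congr 1
      linear_combination (c k : ℂ) ^ 2 * Complex.I_sq
    rw [h5]
    field_simp
    linear_combination (∏ k ∈ Finset.Icc 1 (n + 1), (1 - Complex.I * (c k : ℂ))) * h1
      - 2 * (1 - (m (n + 1) : ℂ)) * h2

lemma natDegree_S_le (hS0 : S 0 = 1)
    (hS : ∀ n : ℕ, 1 ≤ n → S n * C (∏ k ∈ Finset.Icc 1 n, (1 + Complex.I * (c k : ℂ))) =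
      R c d n - C (2 * (1 - (m n : ℂ))) * R c d (n - 1)) (n : ℕ) : (S n).natDegree ≤ n := by
  cases n with
  | zero => simp [hS0]
  | succ n =>
    rw [← natDegree_mul_C (prod_one_add_ne c (n + 1)), hS (n + 1) (by omega)]
    exact (natDegree_sub_le _ _).trans (max_le (R_natDegree_le c d _)
      ((natDegree_C_mul_le _ _).trans ((R_natDegree_le c d _).trans (by omega))))

lemma coeff_S_self (hS0 : S 0 = 1)
    (hS : ∀ n : ℕ, 1 ≤ n → S n * C (∏ k ∈ Finset.Icc 1 n, (1 + Complex.I * (c k : ℂ))) =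
      R c d n - C (2 * (1 - (m n : ℂ))) * R c d (n - 1)) (n : ℕ) : (S n).coeff n = 1 := by
  cases n with
  | zero => simp [hS0]
  | succ n =>
    have h := congrArg (coeff · (n + 1)) (hS (n + 1) (by omega))
    have h1 : (R c d n).coeff (n + 1) = 0 :=
      coeff_eq_zero_of_natDegree_lt ((R_natDegree_le c d n).trans_lt (by omega))
    simp only [coeff_mul_C, coeff_sub, coeff_C_mul, Nat.add_sub_cancel, h1, mul_zero, sub_zero,
      R_coeff_self] at h
    exact mul_right_cancel₀ (prod_one_add_ne c (n + 1)) (h.trans (one_mul _).symm)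

lemma verblunsky_eq
    (hS : ∀ n : ℕ, 1 ≤ n → S n * C (∏ k ∈ Finset.Icc 1 n, (1 + Complex.I * (c k : ℂ))) =
      R c d n - C (2 * (1 - (m n : ℂ))) * R c d (n - 1)) {n : ℕ} (hn : 1 ≤ n) :
    verblunsky S (n - 1) =
      (1 - 2 * (m n : ℂ) - Complex.I * (c n : ℂ)) / (1 + Complex.I * (c n : ℂ)) *
        ∏ k ∈ Finset.Icc 1 n, (1 + Complex.I * (c k : ℂ)) / (1 - Complex.I * (c k : ℂ)) := by
  obtain ⟨n, rfl⟩ := Nat.exists_eq_succ_of_ne_zero (by omega : n ≠ 0)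
  have h := congrArg (coeff · 0) (hS (n + 1) (by omega))
  simp only [coeff_mul_C, coeff_sub, coeff_C_mul, Nat.add_sub_cancel, R_coeff_zero] at h
  replace h := congrArg conj h
  simp only [map_mul, map_sub, map_prod, map_add, map_one, Complex.conj_I, Complex.conj_ofReal,
    Complex.conj_ofNat, neg_mul, sub_neg_eq_add, ← sub_eq_add_neg] at h
  rw [verblunsky, Nat.succ_eq_add_one, Nat.add_sub_cancel, ← coeff_zero_eq_eval_zero,
    Finset.prod_div_distrib]
  have h1 := prod_one_sub_ne c (n + 1)
  have h2 := one_add_ne (c (n + 1))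
  rw [div_mul_div_comm, eq_div_iff (mul_ne_zero h2 h1)]
  rw [Finset.prod_Icc_succ_top (by omega) (fun k => 1 + Complex.I * (c k : ℂ))] at h ⊢
  linear_combination (-(1 + Complex.I * (c (n + 1) : ℂ))) * h

end Szego

/-! ### The Hermitian form and its positivity -/

/-- The sesquilinear form `⟨p, q⟩ = 𝓛[conj p · q]` of the functional with moments `u`. -/
noncomputable def form (u : ℤ → ℂ) (p q : ℂ[X]) : ℂ :=
  p.sum fun j a => conj a * functional u j q

lemma form_eq_sum (u : ℤ → ℂ) {p : ℂ[X]} (q : ℂ[X]) {n : ℕ} (h : p.degree < n) :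
    form u p q = ∑ j ∈ Finset.range n, conj (p.coeff j) * functional u j q := by
  refine Finset.sum_subset (fun j hj => ?_) fun j _ hj => ?_
  · by_contra hn
    exact (mem_support_iff.1 hj)
      (coeff_eq_zero_of_degree_lt (h.trans_le (by simpa using hn)))
  · simp only [notMem_support_iff.1 hj, map_zero, zero_mul]

lemma form_eq_sum_sum (u : ℤ → ℂ) {p q : ℂ[X]} {n : ℕ} (hp : p.natDegree < n)
    (hq : q.natDegree < n) :
    form u p q = ∑ j ∈ Finset.range n, ∑ k ∈ Finset.range n,
      conj (p.coeff j) * q.coeff k * u (j - k) := by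
  rw [form_eq_sum u q (degree_le_natDegree.trans_lt (by exact_mod_cast hp))]
  refine Finset.sum_congr rfl fun j _ => ?_
  rw [functional_eq_sum u j hq, Finset.mul_sum]
  exact Finset.sum_congr rfl fun k _ => by ring

lemma form_add_right (u : ℤ → ℂ) (p q r : ℂ[X]) :
    form u p (q + r) = form u p q + form u p r := by
  simp only [form, Polynomial.sum_def, map_add, mul_add, Finset.sum_add_distrib]

lemma form_C_mul_right (u : ℤ → ℂ) (a : ℂ) (p q : ℂ[X]) :
    form u p (C a * q) = a * form u p q := by
  simp only [form, Polynomial.sum_def, functional_C_mul, Finset.mul_sum]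
  exact Finset.sum_congr rfl fun j _ => by ring

lemma form_conj {u : ℤ → ℂ} (hu : ∀ j, u (-j) = conj (u j)) (p q : ℂ[X]) :
    conj (form u p q) = form u q p := by
  have hp : p.natDegree < max p.natDegree q.natDegree + 1 := by omega
  have hq : q.natDegree < max p.natDegree q.natDegree + 1 := by omega
  rw [form_eq_sum_sum u hp hq, form_eq_sum_sum u hq hp, Finset.sum_comm, map_sum]
  refine Finset.sum_congr rfl fun j _ => ?_
  rw [map_sum]
  refine Finset.sum_congr rfl fun k _ => ?_
  rw [map_mul, map_mul, Complex.conj_conj, ← hu, neg_sub]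
  ring

lemma form_add_left {u : ℤ → ℂ} (hu : ∀ j, u (-j) = conj (u j)) (p q r : ℂ[X]) :
    form u (p + q) r = form u p r + form u q r := by
  rw [← form_conj hu, form_add_right, map_add, form_conj hu, form_conj hu]

lemma form_C_mul_left {u : ℤ → ℂ} (hu : ∀ j, u (-j) = conj (u j)) (a : ℂ) (p q : ℂ[X]) :
    form u (C a * p) q = conj a * form u p q := by
  rw [← form_conj hu, form_C_mul_right, map_mul, form_conj hu]

section Orthogonal

variable {u : ℤ → ℂ} {S : ℕ → ℂ[X]} {h : ℕ → ℝ}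

lemma form_orthogonal (hS : ∀ n k : ℕ, k < n → functional u k (S n) = 0) {n : ℕ} {p : ℂ[X]}
    (hp : p.degree < n) : form u p (S n) = 0 := by
  rw [form_eq_sum u _ hp]
  exact Finset.sum_eq_zero fun j hj => by rw [hS n j (Finset.mem_range.1 hj), mul_zero]

lemma form_orthogonal_self (hS : ∀ n k : ℕ, k < n → functional u k (S n) = 0)
    (hS' : ∀ n : ℕ, functional u n (S n) = h n) {n : ℕ} {p : ℂ[X]} (hp : p.natDegree ≤ n) :
    form u p (S n) = conj (p.coeff n) * h n := by
  rw [form_eq_sum u _ (degree_le_natDegree.trans_lt (by exact_mod_cast Nat.lt_succ_of_le hp)),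
    Finset.sum_range_succ, hS', Finset.sum_eq_zero, zero_add]
  exact fun j hj => by rw [hS n j (Finset.mem_range.1 hj), mul_zero]

/-- A Hermitian functional with an orthogonal sequence of monic polynomials of positive norm is
positive. -/
lemma form_self_nonneg (hu : ∀ j, u (-j) = conj (u j))
    (hS : ∀ n k : ℕ, k < n → functional u k (S n) = 0)
    (hS' : ∀ n : ℕ, functional u n (S n) = h n) (hh : ∀ n, 0 ≤ h n)
    (hdeg : ∀ n, (S n).natDegree ≤ n) (hlead : ∀ n, (S n).coeff n = 1) (n : ℕ) :
    ∀ p : ℂ[X], p.degree < n → ∃ r : ℝ, 0 ≤ r ∧ form u p p = r := by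
  induction n with
  | zero =>
    intro p hp
    have : p = 0 := by
      rw [Nat.cast_zero, ← Nat.cast_zero, degree_lt_iff_coeff_zero] at hp
      ext k
      simpa using hp k (Nat.zero_le k)
    exact ⟨0, le_rfl, by simp [this, form]⟩
  | succ n ih =>
    intro p hp
    -- Removing the leading term leaves q of smaller degree, orthogonal to Sₙ, so the form splits as
    -- |a|²hₙ + ⟨q, q⟩.
    obtain ⟨q, hq⟩ : ∃ q, p = C (p.coeff n) * S n + q := ⟨p - C (p.coeff n) * S n, by ring⟩
    have hqd : q.degree < n := by
      rw [degree_lt_iff_coeff_zero] at hp ⊢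
      intro k hk
      have hc := congrArg (coeff · k) hq
      simp only [coeff_add, coeff_C_mul] at hc
      rcases hk.eq_or_lt with rfl | hk
      · rw [hlead] at hc
        linear_combination -hc
      · rw [hp k hk, coeff_eq_zero_of_natDegree_lt ((hdeg n).trans_lt hk)] at hc
        linear_combination -hc
    obtain ⟨r, hr, hr'⟩ := ih q hqd
    have h1 := form_orthogonal hS hqd
    have h2 : form u (S n) q = 0 := by rw [← form_conj hu, h1, map_zero]
    have h3 := form_orthogonal_self hS hS' (hdeg n)
    rw [hlead, map_one, one_mul] at h3
    refine ⟨Complex.normSq (p.coeff n) * h n + r,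
      add_nonneg (mul_nonneg (Complex.normSq_nonneg _) (hh n)) hr, ?_⟩
    generalize p.coeff n = a at hq
    rw [hq, form_add_right, form_add_left hu, form_add_left hu, form_C_mul_left hu,
      form_C_mul_left hu, form_C_mul_right, form_C_mul_right, h1, h2, h3, hr']
    push_cast
    rw [Complex.normSq_eq_conj_mul_self]
    ring

end Orthogonal

/-! ### Existence of the measure: Fejér means and weak limits -/

section Herglotz

open Filter Topology AddCircle

lemma continuous_zpow_neg (j : ℤ) : Continuous fun ζ : Circle => (ζ : ℂ) ^ (-j) :=
  Continuous.zpow₀ (by fun_prop) _ fun ζ => Or.inl ζ.coe_ne_zero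

/-- A sequence of probability measures on the circle whose moments converge has a weak limit
with the limiting moments. -/
lemma exists_probabilityMeasure_of_tendsto (P : ℕ → Measure Circle)
    (hP : ∀ n, IsProbabilityMeasure (P n)) (u : ℤ → ℂ)
    (hu : ∀ j : ℤ, Tendsto (fun n => ∫ ζ : Circle, (ζ : ℂ) ^ (-j) ∂P n) atTop (𝓝 (u j))) :
    ∃ μ : Measure Circle, IsProbabilityMeasure μ ∧
      ∀ j : ℤ, ∫ ζ : Circle, (ζ : ℂ) ^ (-j) ∂μ = u j := by
  -- Along an ultrafilter the bounded integrals converge for every test function at once, and the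
  -- limit is a positive linear functional, represented by a measure.
  have hle : ((hyperfilter ℕ : Ultrafilter ℕ) : Filter ℕ) ≤ atTop := Nat.hyperfilter_le_atTop
  have hint {f : Circle → ℝ} (hf : Continuous f) (n : ℕ) : Integrable f (P n) :=
    hf.integrable_of_hasCompactSupport (HasCompactSupport.of_compactSpace f)
  have hlim (f : CompactlySupportedContinuousMap Circle ℝ) : ∃ y : ℝ,
      Tendsto (fun n => ∫ ζ, f ζ ∂P n) (hyperfilter ℕ) (𝓝 y) := by
    obtain ⟨M, hM⟩ := isCompact_univ.exists_bound_of_continuousOn (map_continuous f).continuousOn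
    obtain ⟨y, -, hy⟩ := (isCompact_closedBall (0 : ℝ) M).ultrafilter_le_nhds
      ((hyperfilter ℕ).map fun n => ∫ ζ, f ζ ∂P n) (by
        rw [le_principal_iff]
        refine mem_map.2 (univ_mem' fun n => ?_)
        have := norm_integral_le_of_norm_le_const (μ := P n) (f := f) (C := M)
          (Eventually.of_forall fun ζ => hM ζ trivial)
        simpa using this)
    exact ⟨y, hy⟩
  choose Λ hΛ using hlim
  let Λ' : CompactlySupportedContinuousMap Circle ℝ →ₚ[ℝ] ℝ := PositiveLinearMap.mk₀
    { toFun := Λ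
      map_add' := fun f g => tendsto_nhds_unique (hΛ (f + g)) (by
        refine ((hΛ f).add (hΛ g)).congr fun n => ?_
        exact (integral_add (hint (map_continuous f) n) (hint (map_continuous g) n)).symm)
      map_smul' := fun a f => tendsto_nhds_unique (hΛ (a • f)) (by
        refine ((hΛ f).const_mul a).congr fun n => ?_
        exact (integral_const_mul a _).symm) }
    (fun f hf => ge_of_tendsto' (hΛ f) fun n => integral_nonneg fun ζ => hf ζ)
  let μ := RealRMK.rieszMeasure Λ'
  have hμ (f : C(Circle, ℝ)) (y : ℝ) (h : Tendsto (fun n => ∫ ζ, f ζ ∂P n) atTop (𝓝 y)) :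
      ∫ ζ, f ζ ∂μ = y := by
    have h1 := RealRMK.integral_rieszMeasure Λ'
      (CompactlySupportedContinuousMap.continuousMapEquiv f)
    exact h1.trans (tendsto_nhds_unique (hΛ _) (h.mono_left hle))
  have hprob : IsProbabilityMeasure μ := by
    have := hμ 1 1 (by simp)
    simp only [ContinuousMap.one_apply, integral_const, smul_eq_mul, mul_one] at this
    exact ⟨(ENNReal.toReal_eq_one_iff _).1 this⟩
  refine ⟨μ, hprob, fun j => ?_⟩
  have hc : Continuous fun ζ : Circle => (ζ : ℂ) ^ (-j) :=
    continuous_zpow_neg j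
  have hcint (m : Measure Circle) [IsProbabilityMeasure m] :
      Integrable (fun ζ : Circle => (ζ : ℂ) ^ (-j)) m :=
    hc.integrable_of_hasCompactSupport (HasCompactSupport.of_compactSpace _)
  have hre := hμ ⟨_, Complex.continuous_re.comp hc⟩ (u j).re (by
    refine ((Complex.continuous_re.tendsto _).comp (hu j)).congr fun n => ?_
    exact (integral_re (hcint (P n))).symm)
  have him := hμ ⟨_, Complex.continuous_im.comp hc⟩ (u j).im (by
    refine ((Complex.continuous_im.tendsto _).comp (hu j)).congr fun n => ?_
    exact (integral_im (hcint (P n))).symm)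
  apply Complex.ext
  · rw [← hre]; exact (integral_re (hcint μ)).symm
  · rw [← him]; exact (integral_im (hcint μ)).symm

lemma integral_fourier (n : ℤ) :
    ∫ x, fourier n x ∂(haarAddCircle : Measure (AddCircle (1 : ℝ))) = if n = 0 then 1 else 0 := by
  split_ifs with h
  · simp [h]
  · exact integral_eq_zero_of_add_right_eq_neg (μ := haarAddCircle)
      (fourier_add_half_inv_index h one_pos)

/-- The `n`-th Fejér mean of the trigonometric series with coefficients `u`. -/
noncomputable def fejer (u : ℤ → ℂ) (n : ℕ) : C(AddCircle (1 : ℝ), ℂ) :=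
  ∑ j ∈ Finset.range n, ∑ k ∈ Finset.range n, ((n : ℂ)⁻¹ * u (j - k)) • fourier (j - k)

lemma integral_fourier_mul_fejer (u : ℤ → ℂ) (n : ℕ) (l : ℤ) :
    ∫ x, fourier (-l) x * fejer u n x ∂haarAddCircle =
      ∑ j ∈ Finset.range n, ∑ k ∈ Finset.range n,
        if (j : ℤ) - k = l then (n : ℂ)⁻¹ * u l else 0 := by
  have hi (f : C(AddCircle (1 : ℝ), ℂ)) : Integrable f haarAddCircle :=
    (map_continuous f).integrable_of_hasCompactSupport (HasCompactSupport.of_compactSpace _)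
  simp only [fejer, ContinuousMap.coe_sum, Finset.sum_apply, ContinuousMap.coe_smul,
    Pi.smul_apply, Finset.mul_sum, smul_eq_mul]
  have e (j k : ℕ) (x : AddCircle (1 : ℝ)) :
      fourier (-l) x * ((n : ℂ)⁻¹ * u (j - k) * fourier (j - k) x) =
        ((n : ℂ)⁻¹ * u (j - k)) * fourier (j - k - l) x := by
    rw [show (j : ℤ) - k - l = -l + (j - k) by ring, fourier_add]
    ring
  simp only [e]
  rw [integral_finsetSum]
  · refine Finset.sum_congr rfl fun j _ => ?_
    rw [integral_finsetSum]
    · refine Finset.sum_congr rfl fun k _ => ?_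
      rw [integral_const_mul, integral_fourier]
      simp only [sub_eq_zero]
      split_ifs with h
      · rw [h, mul_one]
      · rw [mul_zero]
    · exact fun k _ => (hi _).const_mul _
  · exact fun j _ => integrable_finsetSum _ fun k _ => (hi _).const_mul _

/-- Exactly n - l index pairs satisfy j - k = l; truncated subtraction also covers l ≥ n. -/
lemma integral_fourier_mul_fejer_natCast (u : ℤ → ℂ) (n l : ℕ) :
    ∫ x, fourier (-(l : ℤ)) x * fejer u n x ∂haarAddCircle = (n : ℂ)⁻¹ * (n - l : ℕ) * u l := by
  rw [integral_fourier_mul_fejer]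
  have h (j : ℕ) (hj : j ∈ Finset.range n) : (∑ k ∈ Finset.range n,
      if (j : ℤ) - k = l then (n : ℂ)⁻¹ * u l else 0) =
        if l ≤ j then (n : ℂ)⁻¹ * u l else 0 := by
    have hj := Finset.mem_range.1 hj
    split_ifs with hl
    · rw [Finset.sum_eq_single_of_mem (j - l) (Finset.mem_range.2 (by omega))
        (fun k _ hk => if_neg (by omega)), if_pos (by omega)]
    · exact Finset.sum_eq_zero fun k _ => if_neg (by omega)
  rw [Finset.sum_congr rfl h, ← Finset.sum_filter, Finset.sum_const, nsmul_eq_mul,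
    show (Finset.range n).filter (l ≤ ·) = Finset.Ico l n by ext; simp; omega, Nat.card_Ico]
  ring

lemma fejer_eq_ofReal {u : ℤ → ℂ} (hpos : ∀ (n : ℕ) (a : ℕ → ℂ), ∃ r : ℝ, 0 ≤ r ∧
      ∑ j ∈ Finset.range n, ∑ k ∈ Finset.range n, conj (a j) * a k * u (j - k) = r)
    (n : ℕ) (x : AddCircle (1 : ℝ)) : ∃ r : ℝ, 0 ≤ r ∧ fejer u n x = r := by
  -- With aₖ = e⁻²ᵖⁱⁱᵏˣ the quadratic form is n times the Fejér mean at x.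
  obtain ⟨r, hr, h⟩ := hpos n fun k => fourier (-(k : ℤ)) x
  refine ⟨(n : ℝ)⁻¹ * r, by positivity, ?_⟩
  push_cast
  rw [← h]
  simp only [fejer, ContinuousMap.coe_sum, Finset.sum_apply, ContinuousMap.coe_smul,
    Pi.smul_apply, Finset.mul_sum, smul_eq_mul]
  refine Finset.sum_congr rfl fun j _ => Finset.sum_congr rfl fun k _ => ?_
  rw [← fourier_neg, neg_neg, ← fourier_add, ← sub_eq_add_neg]
  ring

/-- **Herglotz' theorem**: a positive definite sequence is the moment sequence of a measure on the
circle. -/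
theorem exists_probabilityMeasure_moment_eq {u : ℤ → ℂ} (h0 : u 0 = 1)
    (hu : ∀ j, u (-j) = conj (u j))
    (hpos : ∀ (n : ℕ) (a : ℕ → ℂ), ∃ r : ℝ, 0 ≤ r ∧
      ∑ j ∈ Finset.range n, ∑ k ∈ Finset.range n, conj (a j) * a k * u (j - k) = r) :
    ∃ μ : Measure Circle, IsProbabilityMeasure μ ∧
      ∀ j : ℤ, ∫ ζ : Circle, (ζ : ℂ) ^ (-j) ∂μ = u j := by
  have hf (n : ℕ) (x : AddCircle (1 : ℝ)) :
      0 ≤ (fejer u n x).re ∧ ((fejer u n x).re : ℂ) = fejer u n x := by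
    obtain ⟨r, hr, h⟩ := fejer_eq_ofReal hpos n x
    rw [h, Complex.ofReal_re]
    exact ⟨hr, rfl⟩
  have hcont (n : ℕ) : Continuous fun x => (fejer u n x).re :=
    Complex.continuous_re.comp (map_continuous _)
  -- The index is shifted because the Fejér mean of index 0 is zero and has no unit mass.
  let D (n : ℕ) : Measure (AddCircle (1 : ℝ)) :=
    haarAddCircle.withDensity fun x => ENNReal.ofReal (fejer u (n + 1) x).re
  have hmeas : Measurable (toCircle : AddCircle (1 : ℝ) → Circle) :=
    AddCircle.continuous_toCircle.measurable
  have hD (n : ℕ) (g : AddCircle (1 : ℝ) → ℂ) :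
      ∫ x, g x ∂D n = ∫ x, g x * fejer u (n + 1) x ∂haarAddCircle := by
    rw [integral_withDensity_eq_integral_toReal_smul (hcont _).measurable.ennreal_ofReal
      (Eventually.of_forall fun x => ENNReal.ofReal_lt_top)]
    refine integral_congr_ae (Eventually.of_forall fun x => ?_)
    dsimp only
    rw [ENNReal.toReal_ofReal (hf _ x).1, Complex.real_smul, (hf _ x).2, mul_comm]
  have hDnat (n l : ℕ) : ∫ x, fourier (-(l : ℤ)) x ∂D n =
      ((n + 1 : ℕ) : ℂ)⁻¹ * (n + 1 - l : ℕ) * u l := by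
    rw [hD, integral_fourier_mul_fejer_natCast]
  have hprob (n : ℕ) : IsProbabilityMeasure (D n) := by
    have h := hDnat n 0
    have hn : ((n + 1 : ℕ) : ℂ) ≠ 0 := Nat.cast_ne_zero.2 (Nat.succ_ne_zero n)
    simp only [Nat.cast_zero, neg_zero, fourier_zero, integral_const, Nat.sub_zero, h0,
      inv_mul_cancel₀ hn, mul_one, Complex.real_smul] at h
    exact ⟨(ENNReal.toReal_eq_one_iff _).1 (by exact_mod_cast h)⟩
  refine exists_probabilityMeasure_of_tendsto (fun n => (D n).map toCircle)
    (fun n => Measure.isProbabilityMeasure_map hmeas.aemeasurable) u fun j => ?_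
  have hint (n : ℕ) (j : ℤ) : ∫ ζ : Circle, (ζ : ℂ) ^ (-j) ∂(D n).map toCircle =
      ∫ x, fourier (-j) x ∂D n := by
    rw [integral_map hmeas.aemeasurable]
    · simp only [fourier_apply, AddCircle.toCircle_zsmul, Circle.coe_zpow]
    · exact (continuous_zpow_neg j).aestronglyMeasurable
  simp only [hint]
  have hlim (l : ℕ) : Tendsto (fun n => ∫ x, fourier (-(l : ℤ)) x ∂D n) atTop (𝓝 (u l)) := by
    simp only [hDnat]
    have : Tendsto (fun n : ℕ => ((n + 1 : ℕ) : ℂ)⁻¹ * ((n + 1 - l : ℕ) : ℂ)) atTop (𝓝 1) := by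
      have h1 := (tendsto_one_div_add_atTop_nhds_zero_nat (𝕜 := ℂ)).const_mul (l : ℂ)
      have h2 := h1.const_sub 1
      rw [mul_zero, sub_zero] at h2
      refine h2.congr' ?_
      filter_upwards [eventually_ge_atTop l] with n hn
      have hn' : (n : ℂ) + 1 ≠ 0 := Nat.cast_add_one_ne_zero n
      rw [Nat.cast_sub (by omega)]
      push_cast
      field_simp
    simpa using this.mul_const (u l)
  obtain ⟨l, rfl | rfl⟩ := j.eq_nat_or_neg
  · exact hlim l
  · rw [hu]
    refine ((Complex.continuous_conj.tendsto _).comp (hlim l)).congr fun n => ?_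
    rw [Function.comp_apply, ← integral_conj]
    simp only [← fourier_neg]

end Herglotz

/-! ### Uniqueness: moments determine the measure -/

lemma integrable_of_continuous {μ : Measure Circle} [IsFiniteMeasure μ] {f : Circle → ℂ}
    (hf : Continuous f) : Integrable f μ :=
  hf.integrable_of_hasCompactSupport (HasCompactSupport.of_compactSpace f)

/-- The star subalgebra of Laurent polynomials on the circle. -/
noncomputable def laurentSubalgebra : StarSubalgebra ℂ (BoundedContinuousFunction Circle ℂ) where
  toSubalgebra := Algebra.adjoin ℂ (Set.range fun j : ℤ =>
    BoundedContinuousFunction.mkOfCompact ⟨fun ζ : Circle => (ζ : ℂ) ^ (-j), continuous_zpow_neg j⟩)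
  star_mem' := by
    set e : ℤ → BoundedContinuousFunction Circle ℂ := fun j : ℤ =>
      BoundedContinuousFunction.mkOfCompact ⟨fun ζ : Circle => (ζ : ℂ) ^ (-j), continuous_zpow_neg j⟩
    change Algebra.adjoin ℂ (Set.range e) ≤ star (Algebra.adjoin ℂ (Set.range e))
    refine Algebra.adjoin_le ?_
    rintro - ⟨n, rfl⟩
    refine Algebra.subset_adjoin ⟨-n, ?_⟩
    ext ζ
    simp [e, ← Circle.coe_inv_eq_conj]

/-- The monomials are closed under multiplication, so the algebra they generate is their span and
integrals need only be compared on single monomials. -/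
lemma toSubmodule_laurentSubalgebra :
    Subalgebra.toSubmodule laurentSubalgebra.toSubalgebra =
      Submodule.span ℂ (Set.range fun j : ℤ => BoundedContinuousFunction.mkOfCompact
        ⟨fun ζ : Circle => (ζ : ℂ) ^ (-j), continuous_zpow_neg j⟩) := by
  refine Algebra.adjoin_eq_span_of_subset ℂ (Set.Subset.trans ?_ Submodule.subset_span)
  intro x hx
  refine Submonoid.closure_induction (fun _ => id) ⟨0, ?_⟩ ?_ hx
  · ext ζ
    simp
  · rintro - - - - ⟨m, rfl⟩ ⟨n, rfl⟩
    refine ⟨m + n, ?_⟩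
    ext ζ
    simp only [BoundedContinuousFunction.mkOfCompact_apply, ContinuousMap.coe_mk,
      BoundedContinuousFunction.coe_mul, Pi.mul_apply]
    rw [← zpow_add₀ ζ.coe_ne_zero, neg_add]

lemma laurentSubalgebra_separatesPoints :
    (laurentSubalgebra.map
      (BoundedContinuousFunction.toContinuousMapStarₐ ℂ)).SeparatesPoints := by
  intro x y hxy
  refine ⟨fun ζ => (ζ : ℂ) ^ (-(-1) : ℤ), ⟨⟨fun ζ : Circle => (ζ : ℂ) ^ (-(-1) : ℤ),
    continuous_zpow_neg (-1)⟩, ⟨_, Algebra.subset_adjoin ⟨-1, rfl⟩, rfl⟩, rfl⟩, ?_⟩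
  simpa [Circle.coe_inj] using hxy

/-- A finite measure on the circle is determined by its moments. -/
lemma measure_eq_of_moment_eq {μ μ' : Measure Circle} [IsFiniteMeasure μ] [IsFiniteMeasure μ']
    (h : ∀ j : ℤ, ∫ ζ : Circle, (ζ : ℂ) ^ (-j) ∂μ = ∫ ζ : Circle, (ζ : ℂ) ^ (-j) ∂μ') :
    μ = μ' := by
  refine ext_of_forall_mem_subalgebra_integral_eq_of_polish laurentSubalgebra_separatesPoints
    fun g hg => ?_
  replace hg : g ∈ Subalgebra.toSubmodule laurentSubalgebra.toSubalgebra := hg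
  rw [toSubmodule_laurentSubalgebra] at hg
  induction hg using Submodule.span_induction with
  | mem x hx =>
    obtain ⟨j, rfl⟩ := hx
    exact h j
  | zero => simp
  | add x y _ _ hx hy =>
    simp only [BoundedContinuousFunction.coe_add, Pi.add_apply]
    rw [integral_add (x.integrable μ) (y.integrable μ),
      integral_add (x.integrable μ') (y.integrable μ'), hx, hy]
  | smul a x _ hx =>
    simp only [BoundedContinuousFunction.coe_smul]
    rw [integral_smul, integral_smul, hx]

/-! ### From functionals to integrals -/

section Measure

variable {c d : ℕ → ℝ} {μ : Measure Circle}

lemma integral_zpow_mul_one_sub [IsFiniteMeasure μ] (j : ℤ) :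
    ∫ ζ : Circle, (ζ : ℂ) ^ (-j) * (1 - (ζ : ℂ)) ∂μ =
      ∫ ζ : Circle, (ζ : ℂ) ^ (-j) ∂μ - ∫ ζ : Circle, (ζ : ℂ) ^ (-(j - 1)) ∂μ := by
  rw [← integral_sub (integrable_of_continuous (continuous_zpow_neg j))
    (integrable_of_continuous (continuous_zpow_neg (j - 1)))]
  congr 1
  ext ζ
  rw [neg_sub, sub_eq_add_neg 1 j, add_comm, zpow_add₀ ζ.coe_ne_zero, zpow_one]
  ring

/-- The ν-integrals are differences of consecutive moments; total mass 1 fixes the zeroth, and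
telescoping in both directions gives the rest. -/
lemma isAssociatedMeasure_iff :
    IsAssociatedMeasure c d μ ↔ IsProbabilityMeasure μ ∧
      ∀ j : ℤ, ∫ ζ : Circle, (ζ : ℂ) ^ (-j) ∂μ = moment c d j := by
  constructor
  · rintro ⟨hp, h⟩
    refine ⟨hp, fun j => ?_⟩
    simp only [integral_zpow_mul_one_sub, ← moment_sub_moment] at h
    induction j with
    | zero => simp [moment_zero]
    | succ j ih =>
      have := h (j + 1)
      rw [add_sub_cancel_right, ih] at this
      exact sub_left_injective this
    | pred j ih =>
      have := h (-j)
      rw [ih] at this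
      exact sub_right_injective this
  · rintro ⟨hp, h⟩
    refine ⟨hp, fun j => ?_⟩
    rw [integral_zpow_mul_one_sub, h, h, moment_sub_moment]

lemma integral_zpow_mul_eval [IsFiniteMeasure μ] {u : ℤ → ℂ}
    (h : ∀ j : ℤ, ∫ ζ : Circle, (ζ : ℂ) ^ (-j) ∂μ = u j) (k : ℤ) (p : ℂ[X]) :
    ∫ ζ : Circle, (ζ : ℂ) ^ (-k) * p.eval (ζ : ℂ) ∂μ = functional u k p := by
  rw [functional_eq_sum _ _ (Nat.lt_succ_self p.natDegree)]
  have e (ζ : Circle) : (ζ : ℂ) ^ (-k) * p.eval (ζ : ℂ) =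
      ∑ j ∈ Finset.range p.natDegree.succ, (ζ : ℂ) ^ (-(k - j)) * p.coeff j := by
    rw [eval_eq_sum_range, Finset.mul_sum]
    refine Finset.sum_congr rfl fun j _ => ?_
    rw [neg_sub, sub_eq_add_neg (j : ℤ) k, add_comm, zpow_add₀ ζ.coe_ne_zero, zpow_natCast]
    ring
  simp only [e]
  rw [integral_finsetSum _ fun j _ =>
    (integrable_of_continuous (continuous_zpow_neg _)).mul_const _]
  refine Finset.sum_congr rfl fun j _ => ?_
  rw [integral_mul_const, h]

lemma continuous_eval_circle (p : ℂ[X]) : Continuous fun ζ : Circle => p.eval (ζ : ℂ) :=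
  p.continuous.comp (by fun_prop)

lemma integral_conj_eval_mul_eval [IsFiniteMeasure μ] {u : ℤ → ℂ}
    (h : ∀ j : ℤ, ∫ ζ : Circle, (ζ : ℂ) ^ (-j) ∂μ = u j) (p q : ℂ[X]) :
    ∫ ζ : Circle, conj (p.eval (ζ : ℂ)) * q.eval (ζ : ℂ) ∂μ = form u p q := by
  rw [form, Polynomial.sum_def]
  have e (ζ : Circle) : conj (p.eval (ζ : ℂ)) * q.eval (ζ : ℂ) =
      ∑ j ∈ p.support, conj (p.coeff j) * ((ζ : ℂ) ^ (-(j : ℤ)) * q.eval (ζ : ℂ)) := by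
    rw [eval_eq_sum, Polynomial.sum_def, map_sum, Finset.sum_mul]
    refine Finset.sum_congr rfl fun j _ => ?_
    rw [map_mul, map_pow, ← Circle.coe_inv_eq_conj, Circle.coe_inv, zpow_neg, zpow_natCast, inv_pow]
    ring
  simp only [e]
  rw [integral_finsetSum]
  · refine Finset.sum_congr rfl fun j _ => ?_
    rw [integral_const_mul, integral_zpow_mul_eval h]
  · exact fun j _ => (integrable_of_continuous
      ((continuous_zpow_neg j).mul (continuous_eval_circle q))).const_mul _

/-- On a finite support, the monic polynomial with these zeros vanishes almost everywhere, yet its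
pairing with Sₙ of the same degree is hₙ > 0. -/
lemma isNontrivial_of_orthogonal [IsFiniteMeasure μ] {u : ℤ → ℂ} {S : ℕ → ℂ[X]} {h : ℕ → ℝ}
    (hu : ∀ j : ℤ, ∫ ζ : Circle, (ζ : ℂ) ^ (-j) ∂μ = u j)
    (hS : ∀ n k : ℕ, k < n → functional u k (S n) = 0)
    (hS' : ∀ n : ℕ, functional u n (S n) = h n) (hh : ∀ n, 0 < h n) : IsNontrivial μ := by
  intro hfin
  let p : ℂ[X] := ∏ ζ ∈ hfin.toFinset, (X - C (ζ : ℂ))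
  have hp : p.Monic := monic_prod_X_sub_C _ _
  have h1 := form_orthogonal_self hS hS' (le_refl p.natDegree)
  rw [← integral_conj_eval_mul_eval hu, hp.coeff_natDegree, map_one, one_mul] at h1
  refine (hh p.natDegree).ne' (Complex.ofReal_injective (h1.symm.trans ?_))
  refine integral_eq_zero_of_ae ?_
  filter_upwards [Measure.support_mem_ae (μ := μ)] with ζ hζ
  have : p.eval (ζ : ℂ) = 0 := by
    rw [eval_prod]
    exact Finset.prod_eq_zero (hfin.mem_toFinset.2 hζ) (by simp)
  rw [this, map_zero, zero_mul, Pi.zero_apply]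

lemma isMonicOPUC_of_orthogonal [IsFiniteMeasure μ] {u : ℤ → ℂ} {S : ℕ → ℂ[X]} {h : ℕ → ℝ}
    (hu : ∀ j : ℤ, ∫ ζ : Circle, (ζ : ℂ) ^ (-j) ∂μ = u j) (hherm : ∀ j, u (-j) = conj (u j))
    (hS : ∀ n k : ℕ, k < n → functional u k (S n) = 0)
    (hS' : ∀ n : ℕ, functional u n (S n) = h n) (hh : ∀ n, 0 < h n)
    (hdeg : ∀ n, (S n).natDegree ≤ n) (hlead : ∀ n, (S n).coeff n = 1) : IsMonicOPUC μ S := by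
  have hS_deg (n : ℕ) : (S n).natDegree = n :=
    le_antisymm (hdeg n) (le_natDegree_of_ne_zero (by rw [hlead]; exact one_ne_zero))
  refine ⟨fun n => ?_, hS_deg, fun n => (√(h n))⁻¹, fun n => inv_pos.2 (Real.sqrt_pos.2 (hh n)),
    fun k n => ?_⟩
  · rw [Monic, leadingCoeff, hS_deg, hlead]
  · have hlt {k n : ℕ} (hk : k < n) : form u (S k) (S n) = 0 :=
      form_orthogonal hS ((degree_le_of_natDegree_le (hdeg k)).trans_lt (by exact_mod_cast hk))
    rw [integral_conj_eval_mul_eval hu]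
    split_ifs with hkn
    · rw [hkn, form_orthogonal_self hS hS' (hdeg n), hlead, map_one, one_mul]
      norm_cast
      rw [inv_pow, inv_inv, Real.sq_sqrt (hh n).le]
    · rcases lt_or_gt_of_ne hkn with hk | hk
      · exact hlt hk
      · rw [← form_conj hherm, hlt hk, map_zero]

lemma exists_isAssociatedMeasure {S : ℕ → ℂ[X]} {h : ℕ → ℝ}
    (hS : ∀ n k : ℕ, k < n → functional (moment c d) k (S n) = 0)
    (hS' : ∀ n : ℕ, functional (moment c d) n (S n) = h n) (hh : ∀ n, 0 < h n)
    (hdeg : ∀ n, (S n).natDegree ≤ n) (hlead : ∀ n, (S n).coeff n = 1) :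
    ∃ μ, IsAssociatedMeasure c d μ := by
  simp only [isAssociatedMeasure_iff]
  refine exists_probabilityMeasure_moment_eq (moment_zero c d) (moment_neg c d) fun n a => ?_
  let p : ℂ[X] := ∑ k ∈ Finset.range n, C (a k) * X ^ k
  have hc (k : ℕ) : p.coeff k = if k < n then a k else 0 := by
    simp [p, coeff_X_pow]
  -- The bound n + 1 keeps `natDegree` strictly below it even when n = 0; the extra row and column
  -- contribute zero.
  have hp : p.degree < (n + 1 : ℕ) := by
    rw [degree_lt_iff_coeff_zero]
    exact fun k hk => by rw [hc, if_neg (by omega)]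
  have hp' : p.natDegree < n + 1 := Nat.lt_succ_of_le (natDegree_le_iff_coeff_eq_zero.2
    fun k hk => by rw [hc, if_neg (by omega)])
  obtain ⟨r, hr, h1⟩ := form_self_nonneg (moment_neg c d) hS hS' (fun n => (hh n).le) hdeg hlead
    (n + 1) p hp
  refine ⟨r, hr, ?_⟩
  rw [← h1, form_eq_sum_sum _ hp' hp', Finset.sum_range_succ, hc n, if_neg (lt_irrefl n)]
  simp only [map_zero, zero_mul, Finset.sum_const_zero, add_zero]
  refine Finset.sum_congr rfl fun j hj => ?_
  rw [Finset.sum_range_succ, hc n, if_neg (lt_irrefl n), mul_zero, zero_mul, add_zero]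
  refine Finset.sum_congr rfl fun k hk => ?_
  rw [hc, hc, if_pos (Finset.mem_range.1 hj), if_pos (Finset.mem_range.1 hk)]

end Measure

end ChainOPUC

theorem theorem2 (c d m : ℕ → ℝ)
    (hd : ChainOPUC.IsPositiveChainSequence d)
    (hm : ChainOPUC.IsMinimalParameterSequence d m)
    (S : ℕ → Polynomial ℂ)
    (hS_zero : S 0 = 1)
    (hS : ∀ n : ℕ, 1 ≤ n →
      S n * Polynomial.C (∏ k ∈ Finset.Icc 1 n, (1 + Complex.I * (c k : ℂ))) =
        ChainOPUC.R c d n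
          - Polynomial.C (2 * (1 - (m n : ℂ))) * ChainOPUC.R c d (n - 1)) :
    (∃! μ : MeasureTheory.Measure Circle, ChainOPUC.IsAssociatedMeasure c d μ) ∧
    ∀ μ : MeasureTheory.Measure Circle, ChainOPUC.IsAssociatedMeasure c d μ →
      ChainOPUC.IsNontrivial μ ∧
      ChainOPUC.IsMonicOPUC μ S ∧
      ∀ n : ℕ, 1 ≤ n →
        ChainOPUC.verblunsky S (n - 1) =
          (1 - 2 * (m n : ℂ) - Complex.I * (c n : ℂ)) / (1 + Complex.I * (c n : ℂ)) *
            ∏ k ∈ Finset.Icc 1 n,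
              (1 + Complex.I * (c k : ℂ)) / (1 - Complex.I * (c k : ℂ)) := by
  have hp : ChainOPUC.IsParameterSequence d m := hm.1
  have h0 : m 0 = 0 := hm.zero
  have horth (n k : ℕ) (hk : k < n) := ChainOPUC.functional_moment_S hp h0 hS hk
  have hself := ChainOPUC.functional_moment_S_self hp h0 hS_zero hS
  have hpos := ChainOPUC.normSqS_pos (c := c) hp
  have hdeg := ChainOPUC.natDegree_S_le hS_zero hS
  have hlead := ChainOPUC.coeff_S_self hS_zero hS
  refine ⟨?_, fun μ hμ => ?_⟩
  · obtain ⟨μ, hμ⟩ := ChainOPUC.exists_isAssociatedMeasure horth hself hpos hdeg hlead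
    refine ⟨μ, hμ, fun μ' hμ' => ?_⟩
    obtain ⟨_, h1⟩ := ChainOPUC.isAssociatedMeasure_iff.1 hμ
    obtain ⟨_, h2⟩ := ChainOPUC.isAssociatedMeasure_iff.1 hμ'
    exact ChainOPUC.measure_eq_of_moment_eq fun j => (h2 j).trans (h1 j).symm
  · obtain ⟨_, h1⟩ := ChainOPUC.isAssociatedMeasure_iff.1 hμ
    exact ⟨ChainOPUC.isNontrivial_of_orthogonal h1 horth hself hpos,
      ChainOPUC.isMonicOPUC_of_orthogonal h1 (ChainOPUC.moment_neg c d) horth hself hpos hdeg hlead,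
      fun n hn => ChainOPUC.verblunsky_eq hS hn⟩
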